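/- Let $p$ and $q$ be distinct primes with $p \equiv q \equiv 31 \pmod{60}$, and suppose that the class of $p$ does not lie in the subgroup of $(\mathbb{Z}/16\mathbb{Z})^{\times}$ generated by the class of $q$. Then there is no elliptic curve $E$ over $\mathbb{Q}$ of conductor $N = pq$ such that the group $E(\mathbb{Q})$ contains a point of order $2$. -/

import Mathlib

namespace WeierstrassCurve

noncomputable section

section Local

variable {K : Type*} [Field K] (E : WeierstrassCurve K) (ℓ : ℕ)

open scoped Classical in
/-- The `ℓ`-division field `K(E[ℓ])`: the extension of `K` inside its algebraic closure generated
by the affine coordinates of all `ℓ`-torsion points of `E` over the algebraic closure. -/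
def divisionField : IntermediateField K (AlgebraicClosure K) :=
  IntermediateField.adjoin K
    {z | ∃ (x y : AlgebraicClosure K)
        (h : (E.baseChange (AlgebraicClosure K)).toAffine.Nonsingular x y),
      ℓ • (Affine.Point.some x y h) = 0 ∧ (z = x ∨ z = y)}

open scoped Classical in
/-- The group `E[ℓ]` of `ℓ`-torsion points. All of them are rational over `K(E[ℓ])`. -/
def torsionGroup : AddSubgroup (E.baseChange (E.divisionField ℓ)).toAffine.Point :=
  (nsmulAddMonoidHom ℓ).ker

open scoped Classical in
/-- The subgroup `E[ℓ]^H` of the points of `E[ℓ]` that are fixed by a subgroup `H` of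
`Gal(K(E[ℓ])/K)`, which acts on points through their coordinates. -/
def torsionFixed (H : Subgroup (E.divisionField ℓ ≃ₐ[K] E.divisionField ℓ)) :
    AddSubgroup (E.torsionGroup ℓ) where
  carrier := {P | ∀ σ ∈ H, Affine.Point.map (W' := E.toAffine) (σ : E.divisionField ℓ →ₐ[K] E.divisionField ℓ)
    (P : (E.baseChange (E.divisionField ℓ)).toAffine.Point) = P}
  zero_mem' σ _ := map_zero _
  add_mem' {P Q} hP hQ σ hσ := by
    rw [AddSubgroup.coe_add, map_add, hP σ hσ, hQ σ hσ]
  neg_mem' {P} hP σ hσ := by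
    rw [AddSubgroup.coe_neg, map_neg, hP σ hσ]

open scoped Classical in
/-- The dimension of the `𝔽_ℓ`-vector space `E[ℓ] / E[ℓ]^H`. -/
def torsionCodim (H : Subgroup (E.divisionField ℓ ≃ₐ[K] E.divisionField ℓ)) : ℕ :=
  letI : Module (ZMod ℓ) (E.torsionGroup ℓ ⧸ E.torsionFixed ℓ H) :=
    QuotientAddGroup.zmodModule fun P ↦ by
      have hP : ℓ • P = 0 := Subtype.ext P.2
      rw [hP]
      exact zero_mem _
  Module.finrank (ZMod ℓ) (E.torsionGroup ℓ ⧸ E.torsionFixed ℓ H)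

end Local

/-- The `i`-th ramification group, in the lower numbering, of a finite Galois extension `L` of `ℚ_p`:
the automorphisms `σ` with `σ x ≡ x mod 𝔪 ^ (i + 1)` for all `x` in the ring of integers `𝓞_L`
(the integral closure of `ℤ_p` in `L`). As `𝓞_L` is a local ring, its maximal ideal `𝔪` is its
Jacobson radical. -/
def ramificationGroup (p : ℕ) [Fact p.Prime] (L : Type*) [Field L] [Algebra ℚ_[p] L]
    [Algebra ℤ_[p] L] [IsScalarTower ℤ_[p] ℚ_[p] L] (i : ℕ) : Subgroup (L ≃ₐ[ℚ_[p]] L) where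
  carrier := {σ | ∀ x : integralClosure ℤ_[p] L,
    ∃ y ∈ (Ring.jacobson (integralClosure ℤ_[p] L)) ^ (i + 1), (y : L) = σ x - x}
  one_mem' x := ⟨0, zero_mem _, by simp⟩
  mul_mem' {σ τ} hσ hτ x := by
    obtain ⟨y, hy, hy'⟩ := hτ x
    obtain ⟨z, hz, hz'⟩ := hσ ⟨τ x, IsIntegral.map (τ.restrictScalars ℤ_[p]) x.2⟩
    exact ⟨z + y, add_mem hz hy, by simp [hy', hz']⟩
  inv_mem' {σ} hσ x := by
    obtain ⟨y, hy, hy'⟩ := hσ ⟨σ⁻¹ x, IsIntegral.map (σ⁻¹.restrictScalars ℤ_[p]) x.2⟩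
    refine ⟨-y, neg_mem hy, ?_⟩
    simp [hy']

/-- The wild part `δ = ∑_{i ≥ 1} (g_i / g_0) * dim (E[ℓ] / E[ℓ]^{G_i})` of the conductor exponent
of an elliptic curve `E` over `ℚ_p`, computed with a prime `ℓ ≠ p`. Here `G_i` are the ramification
groups of `ℚ_p(E[ℓ]) / ℚ_p` and `g_i` is the order of `G_i`. The sum has finitely many nonzero
terms, because `G_i` is trivial for large `i`. -/
def wildConductorExponent (p : ℕ) [Fact p.Prime] (E : WeierstrassCurve ℚ_[p]) (ℓ : ℕ) : ℚ :=
  ∑ᶠ i : ℕ,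
    (Nat.card (ramificationGroup p (E.divisionField ℓ) (i + 1)) : ℚ) /
      Nat.card (ramificationGroup p (E.divisionField ℓ) 0) *
      E.torsionCodim ℓ (ramificationGroup p (E.divisionField ℓ) (i + 1))

open scoped Classical in
/-- The exponent at `p` of the conductor of an elliptic curve `W` over `ℚ`: it is `0` if `W` has
good reduction at `p`, `1` if it has multiplicative reduction at `p`, and `2 + δ` with the wild
part `δ` if it has additive reduction at `p`. The reduction type is that of a minimal Weierstrass
equation over `ℤ_p`. The wild part does not depend on the auxiliary prime `ℓ ≠ p`; we take the
smallest one. -/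
def conductorExponent (W : WeierstrassCurve ℚ) (p : ℕ) [Fact p.Prime] : ℚ :=
  if ((W.baseChange ℚ_[p]).minimal ℤ_[p]).HasGoodReduction ℤ_[p] then 0
  else if ((W.baseChange ℚ_[p]).minimal ℤ_[p]).HasMultiplicativeReduction ℤ_[p] then 1
  else 2 + wildConductorExponent p (W.baseChange ℚ_[p]) (if p = 2 then 3 else 2)

/-- The elliptic curve `W` over `ℚ` has conductor `N`: `N` is the positive integer whose exponent
at every prime `p` is the conductor exponent of `W` at `p`. -/
def HasConductor (W : WeierstrassCurve ℚ) (N : ℕ) : Prop :=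
  N ≠ 0 ∧ ∀ (p : ℕ) [Fact p.Prime], (N.factorization p : ℚ) = W.conductorExponent p

end

end WeierstrassCurve

/-!
A rational point of order two puts `W` in the form `y² = x³ + a x² + b x`, with discriminant
`16 b² (a² - 4b)`. A conductor `pq` means good reduction at every prime `ℓ ∤ pq`, and there, up to
the scaling `(a, b) ↦ (c² a, c⁴ b)` over `ℚ_ℓ`, the numbers `a`, `b` come from an integral model of
unit discriminant (`isGoodModelAt_of_hasGoodReduction`). For odd `ℓ` it follows that `b` and
`a² - 4b` are units times the same fourth power. For `ℓ = 2` the reduction is ordinary, and the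
exponents of `2` in `b` and `a² - 4b` are, up to the scaling, either `0` and `8` or `4` and `0`
(`norm_two_torsion_model`).

As `ℚ` has class number one, the local scalings come from a global one. This is done by choosing,
among the integral scalings of `(a, b)`, one with `|b|` minimal (`exists_integral_model`). Dividing
out the powers of `2` leaves an equation `A² = 64 M + N` in which `M` and `N` are nonzero integers
divisible by no primes other than `p` and `q` (`exists_sq_eq_of_isGoodModelAt`). Since
`p ≡ q ≡ 1 mod 15`, both `M` and `N` are congruent to their signs modulo `15`; each choice of signs
is excluded by a quadratic non-residue modulo `3` or `5`, or by positivity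
(`sq_ne_of_forall_prime_dvd`).
-/

namespace WeierstrassCurve

/-! ### Two-torsion points at a prime of good reduction -/

/-- The curve `y² = x³ + a x² + b x` over `ℚ` is, up to the scaling `(a, b) ↦ (c² a, c⁴ b)` over
`ℚ_ℓ`, given by `ℓ`-adic integers `A`, `B` for which `B` and `A² - 4B` have the sizes forced by good
reduction at `ℓ`. For odd `ℓ` we have `‖2‖ = 1`, and the condition says that `B` and `A² - 4B` are
units. -/
def IsGoodModelAt (ℓ : ℕ) [Fact ℓ.Prime] (a b : ℚ) : Prop :=
  ∃ u : ℚ_[ℓ], u ≠ 0 ∧ ∃ A B : ℤ_[ℓ], (a : ℚ_[ℓ]) = u ^ 2 * A ∧ (b : ℚ_[ℓ]) = u ^ 4 * B ∧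
    ((‖B‖ = 1 ∧ ‖A ^ 2 - 4 * B‖ = ‖(2 : ℤ_[ℓ])‖ ^ 8) ∨
      (‖B‖ = ‖(2 : ℤ_[ℓ])‖ ^ 4 ∧ ‖A ^ 2 - 4 * B‖ = 1))

lemma IsGoodModelAt.scale {ℓ : ℕ} [Fact ℓ.Prime] {a b : ℚ} (h : IsGoodModelAt ℓ a b) {c : ℚ}
    (hc : c ≠ 0) : IsGoodModelAt ℓ (c ^ 2 * a) (c ^ 4 * b) := by
  obtain ⟨u, hu, A, B, ha, hb, h⟩ := h
  refine ⟨c * u, mul_ne_zero (by exact_mod_cast hc) hu, A, B, ?_, ?_, h⟩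
  · push_cast
    rw [ha]
    ring
  · push_cast
    rw [hb]
    ring

/-- The discriminant of a Weierstrass curve in terms of the model `Y² = X³ + A X² + B X` obtained by
completing the square, rescaling by `X = 4x`, and moving a root `R` of the cubic to the origin. -/
lemma two_torsion_discr {S : Type*} [CommRing S] (V : WeierstrassCurve S)
    {R : S} (hR : R ^ 3 + V.b₂ * R ^ 2 + 8 * V.b₄ * R + 16 * V.b₆ = 0) :
    (8 * V.b₄ + 2 * R * V.b₂ + 3 * R ^ 2) ^ 2 *
      ((V.b₂ + 3 * R) ^ 2 - 4 * (8 * V.b₄ + 2 * R * V.b₂ + 3 * R ^ 2)) = 2 ^ 8 * V.Δ := by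
  rw [Δ]
  linear_combination 64 * V.b₂ ^ 2 * V.b_relation +
    (4 * V.b₂ ^ 3 - 144 * V.b₂ * V.b₄ +
      27 * (16 * V.b₆ - (R ^ 3 + V.b₂ * R ^ 2 + 8 * V.b₄ * R))) * hR

/-- Over `ℤ_2`, an even root of the rescaled two-division polynomial excludes supersingular
reduction: if `a₁` were even too, then so would be `b₆` and the discriminant. -/
lemma not_two_dvd_a₁ (V : WeierstrassCurve ℤ_[2]) (hΔ : IsUnit V.Δ) {R : ℤ_[2]}
    (hR : R ^ 3 + V.b₂ * R ^ 2 + 8 * V.b₄ * R + 16 * V.b₆ = 0) (h2 : 2 ∣ R) : ¬ 2 ∣ V.a₁ := by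
  rintro ⟨m, hm⟩
  have hp : Prime (2 : ℤ_[2]) := by exact_mod_cast PadicInt.prime_p (p := 2)
  have h0 : (2 : ℤ_[2]) ≠ 0 := hp.ne_zero
  obtain ⟨c, hc⟩ : ∃ c, V.b₂ = 4 * c := ⟨m ^ 2 + V.a₂, by rw [b₂, hm]; ring⟩
  obtain ⟨R₁, rfl⟩ := h2
  rw [hc] at hR
  have e1 : R₁ ^ 3 + 2 * (c * R₁ ^ 2 + V.b₄ * R₁ + V.b₆) = 0 :=
    mul_left_cancel₀ (pow_ne_zero 3 h0) (by linear_combination hR)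
  obtain ⟨R₂, rfl⟩ : 2 ∣ R₁ := hp.dvd_of_dvd_pow (n := 3)
    ⟨-(c * R₁ ^ 2 + V.b₄ * R₁ + V.b₆), by linear_combination e1⟩
  have hb6 : V.b₆ = 2 * -(2 * R₂ ^ 3 + 2 * c * R₂ ^ 2 + V.b₄ * R₂) :=
    mul_left_cancel₀ h0 (by linear_combination e1)
  refine hp.not_isUnit (isUnit_of_dvd_unit ?_ hΔ)
  rw [Δ, hc, hb6]
  set k := -(2 * R₂ ^ 3 + 2 * c * R₂ ^ 2 + V.b₄ * R₂)
  exact ⟨-(8 * c ^ 2 * V.b₈) - 4 * V.b₄ ^ 3 - 54 * k ^ 2 + 36 * c * V.b₄ * k, by ring⟩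

lemma padicInt_two_dvd_or (x : ℤ_[2]) : 2 ∣ x ∨ ∃ k, x = 2 * k + 1 := by
  have h := PadicInt.sub_zmodRepr_mem x
  rw [PadicInt.maximalIdeal_eq_span_p, Ideal.mem_span_singleton] at h
  have h2 := PadicInt.zmodRepr_lt_p x
  obtain ⟨k, hk⟩ := h
  push_cast at hk
  interval_cases x.zmodRepr
  · exact Or.inl ⟨k, by simpa using hk⟩
  · exact Or.inr ⟨k, by rw [← hk]; simp⟩

lemma padicInt_norm_two_mul_add_one (k : ℤ_[2]) : ‖2 * k + 1‖ = 1 := by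
  by_contra h
  have h1 : ‖2 * k + 1‖ < 1 := lt_of_le_of_ne (PadicInt.norm_le_one _) h
  have h2 : (2 : ℤ_[2]) ∣ 2 * k + 1 := by exact_mod_cast (PadicInt.norm_lt_one_iff_dvd _).1 h1
  have hp : Prime (2 : ℤ_[2]) := by exact_mod_cast PadicInt.prime_p (p := 2)
  exact hp.not_isUnit (isUnit_of_dvd_one ((dvd_add_right (dvd_mul_right 2 k)).1 h2))

lemma padicInt_norm_two {ℓ : ℕ} [hℓ : Fact ℓ.Prime] (h : ℓ ≠ 2) : ‖(2 : ℤ_[ℓ])‖ = 1 := by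
  have := PadicInt.norm_natCast_eq_one_iff (p := ℓ) (n := 2)
  exact_mod_cast this.2 ((Nat.coprime_primes hℓ.out Nat.prime_two).2 h)

/-- The sizes of `B` and `A² - 4B` for the model `Y² = X³ + A X² + B X` of a curve with good
reduction. -/
lemma norm_two_torsion_model {ℓ : ℕ} [Fact ℓ.Prime] (V : WeierstrassCurve ℤ_[ℓ])
    (hΔ : IsUnit V.Δ) {R : ℤ_[ℓ]}
    (hR : R ^ 3 + V.b₂ * R ^ 2 + 8 * V.b₄ * R + 16 * V.b₆ = 0) {A B : ℤ_[ℓ]}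
    (hA : A = V.b₂ + 3 * R) (hB : B = 8 * V.b₄ + 2 * R * V.b₂ + 3 * R ^ 2) :
    (‖B‖ = 1 ∧ ‖A ^ 2 - 4 * B‖ = ‖(2 : ℤ_[ℓ])‖ ^ 8) ∨
      (‖B‖ = ‖(2 : ℤ_[ℓ])‖ ^ 4 ∧ ‖A ^ 2 - 4 * B‖ = 1) := by
  have key : ‖B‖ ^ 2 * ‖A ^ 2 - 4 * B‖ = ‖(2 : ℤ_[ℓ])‖ ^ 8 := by
    have h := congrArg norm (two_torsion_discr V hR)
    rw [← hA, ← hB] at h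
    simpa [PadicInt.isUnit_iff.1 hΔ] using h
  rcases eq_or_ne ℓ 2 with rfl | hℓ
  · rcases padicInt_two_dvd_or R with h2 | ⟨k, hk⟩
    · -- `R` even: `a₁` is odd, hence so are `b₂`, `A` and `A² - 4B`.
      right
      obtain ⟨m, hm⟩ := (padicInt_two_dvd_or V.a₁).resolve_left (not_two_dvd_a₁ V hΔ hR h2)
      obtain ⟨R₁, rfl⟩ := h2
      have hD : ‖A ^ 2 - 4 * B‖ = 1 := by
        have hA' : A = 2 * (2 * m ^ 2 + 2 * m + 2 * V.a₂ + 3 * R₁) + 1 := by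
          rw [hA, b₂, hm]
          ring
        rw [show A ^ 2 - 4 * B = 2 * (2 * (2 * m ^ 2 + 2 * m + 2 * V.a₂ + 3 * R₁) ^ 2 +
          2 * (2 * m ^ 2 + 2 * m + 2 * V.a₂ + 3 * R₁) - 2 * B) + 1 by rw [hA']; ring]
        exact padicInt_norm_two_mul_add_one _
      refine ⟨?_, hD⟩
      rw [hD, mul_one] at key
      exact (pow_left_inj₀ (norm_nonneg _) (by positivity) two_ne_zero).1 (by rw [key, ← pow_mul])
    · left
      have h1 : ‖B‖ = 1 := by
        rw [show B = 2 * (4 * V.b₄ + R * V.b₂ + 6 * k ^ 2 + 6 * k + 1) + 1 by rw [hB, hk]; ring]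
        exact padicInt_norm_two_mul_add_one _
      exact ⟨h1, by simpa [h1] using key⟩
  · left
    rw [padicInt_norm_two hℓ, one_pow] at key ⊢
    have h1 := PadicInt.norm_le_one B
    have h2 := PadicInt.norm_le_one (A ^ 2 - 4 * B)
    have h3 := norm_nonneg B
    have h4 := norm_nonneg (A ^ 2 - 4 * B)
    have h5 : ‖B‖ = 1 := by nlinarith
    exact ⟨h5, by simpa [h5] using key⟩

lemma isUnit_integralModel_Δ {ℓ : ℕ} [Fact ℓ.Prime] (E : WeierstrassCurve ℚ_[ℓ])
    (h : E.HasGoodReduction ℤ_[ℓ]) : IsUnit (E.integralModel ℤ_[ℓ]).Δ := by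
  have h1 := ((hasGoodReduction_iff_isElliptic_reduction ℤ_[ℓ]).1 h).isUnit
  rw [reduction, map_Δ] at h1
  exact isUnit_of_map_unit _ _ h1

/-- A root of the two-division polynomial of `W` gives the model
`y² = x³ + (b₂ + 12x) x² + (8b₄ + 8b₂x + 48x²) x`; it has the expected sizes at every prime of good
reduction. -/
lemma isGoodModelAt_of_hasGoodReduction (W : WeierstrassCurve ℚ) {x : ℚ}
    (hx : 4 * x ^ 3 + W.b₂ * x ^ 2 + 2 * W.b₄ * x + W.b₆ = 0) (ℓ : ℕ) [Fact ℓ.Prime]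
    (h : ((W.baseChange ℚ_[ℓ]).minimal ℤ_[ℓ]).HasGoodReduction ℤ_[ℓ]) :
    IsGoodModelAt ℓ (W.b₂ + 12 * x) (8 * W.b₄ + 8 * W.b₂ * x + 48 * x ^ 2) := by
  obtain ⟨C, hC⟩ : ∃ C : VariableChange ℚ_[ℓ],
      (W.baseChange ℚ_[ℓ]).minimal ℤ_[ℓ] = C • W.baseChange ℚ_[ℓ] := ⟨_, rfl⟩
  have hΔ := isUnit_integralModel_Δ _ h
  have h2 := integralModel_b₂_eq ℤ_[ℓ] ((W.baseChange ℚ_[ℓ]).minimal ℤ_[ℓ])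
  have h4 := integralModel_b₄_eq ℤ_[ℓ] ((W.baseChange ℚ_[ℓ]).minimal ℤ_[ℓ])
  have h6 := integralModel_b₆_eq ℤ_[ℓ] ((W.baseChange ℚ_[ℓ]).minimal ℤ_[ℓ])
  set V := ((W.baseChange ℚ_[ℓ]).minimal ℤ_[ℓ]).integralModel ℤ_[ℓ]
  rw [hC] at h2 h4 h6
  rw [variableChange_b₂] at h2
  rw [variableChange_b₄] at h4
  rw [variableChange_b₆] at h6
  have hx' : 4 * (x : ℚ_[ℓ]) ^ 3 + W.b₂ * (x : ℚ_[ℓ]) ^ 2 + 2 * W.b₄ * x + W.b₆ = 0 := by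
    exact_mod_cast congrArg (Rat.cast : ℚ → ℚ_[ℓ]) hx
  simp only [baseChange, map_b₂, map_b₄, map_b₆, eq_ratCast] at h2 h4 h6
  have hu : (C.u : ℚ_[ℓ]) ≠ 0 := C.u.ne_zero
  have hui : ((C.u⁻¹ : ℚ_[ℓ]ˣ) : ℚ_[ℓ]) = (C.u : ℚ_[ℓ])⁻¹ := by simp
  rw [hui] at h2 h4 h6
  set u : ℚ_[ℓ] := (C.u : ℚ_[ℓ])
  set r := C.r
  set R' : ℚ_[ℓ] := 4 * (u⁻¹ ^ 2 * (x - r)) with hR'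
  have hroot : R' ^ 3 + algebraMap ℤ_[ℓ] ℚ_[ℓ] V.b₂ * R' ^ 2 +
      8 * algebraMap ℤ_[ℓ] ℚ_[ℓ] V.b₄ * R' + 16 * algebraMap ℤ_[ℓ] ℚ_[ℓ] V.b₆ = 0 := by
    rw [h2, h4, h6, hR']
    linear_combination 16 * u⁻¹ ^ 6 * hx'
  obtain ⟨R, hR⟩ : ∃ R : ℤ_[ℓ], algebraMap ℤ_[ℓ] ℚ_[ℓ] R = R' := by
    refine IsIntegrallyClosed.isIntegral_iff.1
      ⟨Polynomial.X ^ 3 + (Polynomial.C V.b₂ * Polynomial.X ^ 2 +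
        Polynomial.C (8 * V.b₄) * Polynomial.X + Polynomial.C (16 * V.b₆)),
        ?_, ?_⟩
    · exact Polynomial.monic_X_pow_add (by
        refine lt_of_le_of_lt (Polynomial.degree_quadratic_le) (by norm_num))
    · rw [← hroot]
      simp only [Polynomial.eval₂_add, Polynomial.eval₂_mul, Polynomial.eval₂_pow,
        Polynomial.eval₂_X, Polynomial.eval₂_C, map_mul, map_ofNat,
        Polynomial.eval₂_ofNat]
      ring
  rw [← hR] at hroot
  have hrootZ : R ^ 3 + V.b₂ * R ^ 2 + 8 * V.b₄ * R + 16 * V.b₆ = 0 := by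
    apply IsFractionRing.injective ℤ_[ℓ] ℚ_[ℓ]
    simpa only [map_add, map_mul, map_pow, map_ofNat, map_zero] using hroot
  refine ⟨u, hu, _, _, ?_, ?_, norm_two_torsion_model V hΔ hrootZ rfl rfl⟩
  · rw [← PadicInt.algebraMap_apply]
    simp only [map_add, map_mul, map_ofNat, h2, hR, hR']
    push_cast
    field_simp
    ring
  · rw [← PadicInt.algebraMap_apply]
    simp only [map_add, map_mul, map_pow, map_ofNat, h2, h4, hR, hR']
    push_cast
    field_simp
    ring

/-! ### From the conductor to reduction types -/

/-- A curve of conductor exponent zero has good reduction: the exponent is at least `1` otherwise,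
the wild part being nonnegative. -/
lemma hasGoodReduction_of_conductorExponent_eq_zero (W : WeierstrassCurve ℚ) (ℓ : ℕ)
    [Fact ℓ.Prime] (h : W.conductorExponent ℓ = 0) :
    ((W.baseChange ℚ_[ℓ]).minimal ℤ_[ℓ]).HasGoodReduction ℤ_[ℓ] := by
  unfold conductorExponent at h
  have hwild (m : ℕ) : 0 ≤ wildConductorExponent ℓ (W.baseChange ℚ_[ℓ]) m :=
    finsum_nonneg fun i ↦ by positivity
  by_contra h1
  rw [if_neg h1] at h
  split_ifs at h
  · exact one_ne_zero h
  · linarith [hwild 3]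
  · linarith [hwild 2]

lemma hasGoodReduction_of_hasConductor {W : WeierstrassCurve ℚ} {N : ℕ} (h : W.HasConductor N)
    (ℓ : ℕ) [Fact ℓ.Prime] (hℓ : ¬ ℓ ∣ N) :
    ((W.baseChange ℚ_[ℓ]).minimal ℤ_[ℓ]).HasGoodReduction ℤ_[ℓ] :=
  hasGoodReduction_of_conductorExponent_eq_zero W ℓ <| by
    rw [← h.2 ℓ, Nat.factorization_eq_zero_of_not_dvd hℓ, Nat.cast_zero]

/-- A point of order two has as `x`-coordinate a root of the two-division polynomial. -/
lemma exists_root_of_addOrderOf_eq_two {F : Type*} [Field F] [DecidableEq F]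
    (W : WeierstrassCurve F) {P : W.toAffine.Point} (hP : addOrderOf P = 2) :
    ∃ x : F, 4 * x ^ 3 + W.b₂ * x ^ 2 + 2 * W.b₄ * x + W.b₆ = 0 := by
  have h2 : P + P = 0 := by rw [← two_nsmul, ← hP, addOrderOf_nsmul_eq_zero]
  rcases P with _ | ⟨x, y, hxy⟩
  · have h0 : addOrderOf (0 : W.toAffine.Point) = 2 := hP
    simp at h0
  · have hy : y = W.toAffine.negY x y := by
      by_contra hne
      rw [Affine.Point.add_self_of_Y_ne hne] at h2
      exact Affine.Point.some_ne_zero _ h2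
    have heq := (Affine.equation_iff _ _).1 hxy.1
    rw [Affine.negY] at hy
    refine ⟨x, ?_⟩
    rw [b₂, b₄, b₆]
    linear_combination -4 * heq + (2 * y + W.a₁ * x + W.a₃) * hy

/-! ### Descent to integral coefficients -/

/-- An integral pair `(a, b)` that is a good model at `ℓ` either can be scaled down by `ℓ`, or has
the sizes of `IsGoodModelAt` itself. -/
lemma IsGoodModelAt.dvd_or_norm {ℓ : ℕ} [hℓ : Fact ℓ.Prime] {a b : ℤ}
    (h : IsGoodModelAt ℓ (a : ℚ) (b : ℚ)) :
    ((ℓ : ℤ) ^ 2 ∣ a ∧ (ℓ : ℤ) ^ 4 ∣ b) ∨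
      ((‖(b : ℤ_[ℓ])‖ = 1 ∧ ‖((a ^ 2 - 4 * b : ℤ) : ℤ_[ℓ])‖ = ‖(2 : ℤ_[ℓ])‖ ^ 8) ∨
        (‖(b : ℤ_[ℓ])‖ = ‖(2 : ℤ_[ℓ])‖ ^ 4 ∧ ‖((a ^ 2 - 4 * b : ℤ) : ℤ_[ℓ])‖ = 1)) := by
  obtain ⟨u, hu, A, B, ha, hb, h⟩ := h
  have hna : ‖(a : ℤ_[ℓ])‖ = ‖u‖ ^ 2 * ‖A‖ := by
    rw [PadicInt.norm_intCast_eq_padic_norm, PadicInt.norm_def, ← norm_pow, ← norm_mul, ← ha]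
    simp
  have hnb : ‖(b : ℤ_[ℓ])‖ = ‖u‖ ^ 4 * ‖B‖ := by
    rw [PadicInt.norm_intCast_eq_padic_norm, PadicInt.norm_def, ← norm_pow, ← norm_mul, ← hb]
    simp
  have hnD : ‖((a ^ 2 - 4 * b : ℤ) : ℤ_[ℓ])‖ = ‖u‖ ^ 4 * ‖A ^ 2 - 4 * B‖ := by
    rw [PadicInt.norm_intCast_eq_padic_norm, PadicInt.norm_def, ← norm_pow, ← norm_mul]
    congr 1
    rw [Rat.cast_intCast] at ha hb
    push_cast
    rw [ha, hb, show ((4 : ℤ_[ℓ]) : ℚ_[ℓ]) = 4 from map_ofNat PadicInt.Coe.ringHom 4]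
    ring
  rcases lt_trichotomy ‖u‖ 1 with hlt | heq | hgt
  · left
    have hu1 : ‖u‖ ≤ (ℓ : ℝ) ^ (-1 : ℤ) := by
      simpa using (Padic.norm_lt_pow_iff_norm_le_pow_sub_one u 0).1 (by simpa using hlt)
    have hpow (n : ℕ) : ‖u‖ ^ n ≤ (ℓ : ℝ) ^ (-(n : ℤ)) := by
      calc ‖u‖ ^ n ≤ ((ℓ : ℝ) ^ (-1 : ℤ)) ^ n := pow_le_pow_left₀ (norm_nonneg _) hu1 n
        _ = (ℓ : ℝ) ^ (-(n : ℤ)) := by simp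
    constructor
    · refine PadicInt.norm_int_le_pow_iff_dvd.1 ?_
      rw [hna]
      exact (mul_le_of_le_one_right (by positivity) (PadicInt.norm_le_one A)).trans (hpow 2)
    · refine PadicInt.norm_int_le_pow_iff_dvd.1 ?_
      rw [hnb]
      exact (mul_le_of_le_one_right (by positivity) (PadicInt.norm_le_one B)).trans (hpow 4)
  · right
    rw [hnb, hnD, heq]
    simpa using h
  · -- One of `B` and `A² - 4B` is a unit, so `b` or `a² - 4b` would not be integral.
    exfalso
    have h4 : 1 < ‖u‖ ^ 4 := one_lt_pow₀ hgt (by norm_num)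
    have hb1 := PadicInt.norm_le_one (b : ℤ_[ℓ])
    have hD1 := PadicInt.norm_le_one ((a ^ 2 - 4 * b : ℤ) : ℤ_[ℓ])
    rcases h with ⟨h, -⟩ | ⟨-, h⟩
    · rw [hnb, h] at hb1
      linarith
    · rw [hnD, h] at hD1
      linarith

/-- Among the integral scalings of a rational pair, one with `|b|` minimal has the expected sizes at
all good primes simultaneously. -/
lemma exists_integral_model {S : Set ℕ} {a₀ b₀ : ℚ} (hb₀ : b₀ ≠ 0) (hD₀ : a₀ ^ 2 - 4 * b₀ ≠ 0)
    (h : ∀ (ℓ : ℕ) [Fact ℓ.Prime], ℓ ∉ S → IsGoodModelAt ℓ a₀ b₀) :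
    ∃ a b : ℤ, b ≠ 0 ∧ a ^ 2 - 4 * b ≠ 0 ∧ ∀ (ℓ : ℕ) [Fact ℓ.Prime], ℓ ∉ S →
      ((‖(b : ℤ_[ℓ])‖ = 1 ∧ ‖((a ^ 2 - 4 * b : ℤ) : ℤ_[ℓ])‖ = ‖(2 : ℤ_[ℓ])‖ ^ 8) ∨
        (‖(b : ℤ_[ℓ])‖ = ‖(2 : ℤ_[ℓ])‖ ^ 4 ∧ ‖((a ^ 2 - 4 * b : ℤ) : ℤ_[ℓ])‖ = 1)) := by
  classical
  have hex : ∃ m : ℕ, ∃ a b : ℤ, ∃ c : ℚ, c ≠ 0 ∧ (a : ℚ) = c ^ 2 * a₀ ∧ (b : ℚ) = c ^ 4 * b₀ ∧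
      b.natAbs = m := by
    refine ⟨_, a₀.num * a₀.den * b₀.den ^ 2, b₀.num * a₀.den ^ 4 * b₀.den ^ 3, a₀.den * b₀.den,
      by simp, ?_, ?_, rfl⟩
    · push_cast
      linear_combination (-(a₀.den * b₀.den ^ 2 : ℚ)) * Rat.mul_den_eq_num a₀
    · push_cast
      linear_combination (-(a₀.den ^ 4 * b₀.den ^ 3 : ℚ)) * Rat.mul_den_eq_num b₀
  obtain ⟨a, b, c, hc, ha, hb, hm⟩ := Nat.find_spec hex
  have hb0 : b ≠ 0 := by
    rintro rfl
    rw [Int.cast_zero] at hb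
    exact mul_ne_zero (pow_ne_zero 4 hc) hb₀ hb.symm
  refine ⟨a, b, hb0, fun hD ↦ ?_, fun ℓ hℓ hS ↦ ?_⟩
  · have hD' : (a : ℚ) ^ 2 - 4 * b = 0 := by exact_mod_cast hD
    rw [ha, hb] at hD'
    exact mul_ne_zero (pow_ne_zero 4 hc) hD₀ (by linear_combination hD')
  · have hgood : IsGoodModelAt ℓ (a : ℚ) (b : ℚ) := by
      rw [ha, hb]
      exact (h ℓ hS).scale hc
    refine hgood.dvd_or_norm.resolve_left ?_
    rintro ⟨⟨a', ha'⟩, ⟨b', hb'⟩⟩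
    have hℓ0 : (ℓ : ℚ) ≠ 0 := by exact_mod_cast hℓ.out.ne_zero
    have hle : Nat.find hex ≤ b'.natAbs := by
      refine Nat.find_min' hex ⟨a', b', c / ℓ, div_ne_zero hc hℓ0, ?_, ?_, rfl⟩
      · have : (a : ℚ) = ℓ ^ 2 * a' := by exact_mod_cast ha'
        rw [div_pow, div_mul_eq_mul_div, ← ha, this]
        field_simp
      · have : (b : ℚ) = ℓ ^ 4 * b' := by exact_mod_cast hb'
        rw [div_pow, div_mul_eq_mul_div, ← hb, this]
        field_simp
    have hpos : 0 < b'.natAbs := by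
      rw [Int.natAbs_pos]
      rintro rfl
      exact hb0 (by simpa using hb')
    have hlt : 1 < ℓ ^ 4 := Nat.one_lt_pow (by norm_num) hℓ.out.one_lt
    rw [← hm, hb', Int.natAbs_mul, Int.natAbs_pow, Int.natAbs_natCast] at hle
    nlinarith

/-- Good reduction outside `S`, with `2 ∉ S`, leads to an equation `A² = 64 M + N` whose right-hand
side involves only primes of `S`. -/
lemma exists_sq_eq_of_isGoodModelAt {S : Set ℕ} (h2 : 2 ∉ S) {a₀ b₀ : ℚ} (hb₀ : b₀ ≠ 0)
    (hD₀ : a₀ ^ 2 - 4 * b₀ ≠ 0)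
    (h : ∀ (ℓ : ℕ) [Fact ℓ.Prime], ℓ ∉ S → IsGoodModelAt ℓ a₀ b₀) :
    ∃ A M N : ℤ, A ^ 2 = 64 * M + N ∧ M ≠ 0 ∧ N ≠ 0 ∧
      ∀ ℓ : ℕ, ℓ.Prime → (ℓ : ℤ) ∣ M ∨ (ℓ : ℤ) ∣ N → ℓ ∈ S := by
  obtain ⟨a, b, hb, hD, hnorm⟩ := exists_integral_model hb₀ hD₀ h
  set D := a ^ 2 - 4 * b with hDdef
  have hodd (ℓ : ℕ) [Fact ℓ.Prime] (hS : ℓ ∉ S) (hℓ : ℓ ≠ 2) :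
      ‖(b : ℤ_[ℓ])‖ = 1 ∧ ‖(D : ℤ_[ℓ])‖ = 1 := by
    simpa [padicInt_norm_two hℓ] using hnorm ℓ hS
  have hn2 : ‖(2 : ℤ_[2])‖ = (2 : ℝ)⁻¹ := by exact_mod_cast PadicInt.norm_p (p := 2)
  have not_dvd {ℓ : ℕ} [Fact ℓ.Prime] {x : ℤ} (hx : ‖(x : ℤ_[ℓ])‖ = 1) : ¬ (ℓ : ℤ) ∣ x :=
    fun hdvd ↦ ((PadicInt.norm_int_lt_one_iff_dvd x).2 hdvd).ne hx
  have norm_of_mul {ℓ : ℕ} [Fact ℓ.Prime] {x : ℤ} {k : ℕ}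
      (hx : ‖((2 ^ k * x : ℤ) : ℤ_[ℓ])‖ = ‖(2 : ℤ_[ℓ])‖ ^ k) : ‖(x : ℤ_[ℓ])‖ = 1 := by
    push_cast at hx
    rw [norm_mul, norm_pow] at hx
    have h0 : ‖(2 : ℤ_[ℓ])‖ ^ k ≠ 0 := pow_ne_zero k (norm_ne_zero_iff.2 two_ne_zero)
    exact mul_left_cancel₀ h0 (by rw [hx, mul_one])
  have two_pow_dvd {x : ℤ} {k : ℕ} (hx : ‖(x : ℤ_[2])‖ = ‖(2 : ℤ_[2])‖ ^ k) : 2 ^ k ∣ x := by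
    have := (PadicInt.norm_int_le_pow_iff_dvd (p := 2) (k := x) (n := k)).1 (by rw [hx, hn2]; simp)
    exact_mod_cast this
  rcases hnorm 2 h2 with ⟨hb2, hD2⟩ | ⟨hb2, hD2⟩
  · obtain ⟨M, hM⟩ := two_pow_dvd hD2
    obtain ⟨A, rfl⟩ : 2 ∣ a :=
      Int.prime_two.dvd_of_dvd_pow (n := 2) ⟨2 ^ 7 * M + 2 * b, by linarith⟩
    refine ⟨A, M, b, by linarith, ?_, hb, fun ℓ hℓ hdvd ↦ ?_⟩
    · rintro rfl
      exact hD (by simpa using hM)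
    · by_contra hS
      have : Fact ℓ.Prime := ⟨hℓ⟩
      rcases eq_or_ne ℓ 2 with rfl | hne
      · exact hdvd.elim (not_dvd (norm_of_mul (hM ▸ hD2))) (not_dvd hb2)
      · obtain ⟨h1, h3⟩ := hodd ℓ hS hne
        refine hdvd.elim (not_dvd (norm_of_mul (k := 8) ?_)) (not_dvd h1)
        rw [← hM, h3, padicInt_norm_two hne, one_pow]
  · obtain ⟨M, hM⟩ := two_pow_dvd hb2
    refine ⟨a, M, D, by linarith, ?_, hD, fun ℓ hℓ hdvd ↦ ?_⟩
    · rintro rfl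
      exact hb (by simpa using hM)
    · by_contra hS
      have : Fact ℓ.Prime := ⟨hℓ⟩
      rcases eq_or_ne ℓ 2 with rfl | hne
      · exact hdvd.elim (not_dvd (norm_of_mul (hM ▸ hb2))) (not_dvd hD2)
      · obtain ⟨h1, h3⟩ := hodd ℓ hS hne
        refine hdvd.elim (not_dvd (norm_of_mul (k := 4) ?_)) (not_dvd h3)
        rw [← hM, h1, padicInt_norm_two hne, one_pow]

end WeierstrassCurve

/-! ### The equation `A² = 64 M + N` modulo `15` -/

lemma Nat.cast_eq_one_of_forall_prime_dvd {R : Type*} [CommSemiring R] {n : ℕ} (hn : n ≠ 0)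
    (h : ∀ ℓ : ℕ, ℓ.Prime → ℓ ∣ n → (ℓ : R) = 1) : (n : R) = 1 := by
  induction n using induction_on_primes with
  | zero => exact absurd rfl hn
  | one => exact Nat.cast_one
  | prime_mul ℓ m hℓ ih =>
    rw [Nat.cast_mul, h ℓ hℓ (dvd_mul_right ℓ m), one_mul]
    exact ih (right_ne_zero_of_mul hn) fun r hr hrm ↦ h r hr (hrm.mul_left ℓ)

lemma Int.pos_or_neg_cast_eq {R : Type*} [CommRing R] {n : ℤ} (hn : n ≠ 0)
    (h : ∀ ℓ : ℕ, ℓ.Prime → (ℓ : ℤ) ∣ n → (ℓ : R) = 1) :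
    (0 < n ∧ (n : R) = 1) ∨ (n < 0 ∧ (n : R) = -1) := by
  have h1 : (n.natAbs : R) = 1 := Nat.cast_eq_one_of_forall_prime_dvd (Int.natAbs_ne_zero.2 hn)
    fun ℓ hℓ hdvd ↦ h ℓ hℓ (Int.natCast_dvd.2 hdvd)
  rcases lt_or_gt_of_ne hn with hneg | hpos
  · right
    refine ⟨hneg, ?_⟩
    rw [← h1, ← Int.cast_natCast, Int.ofNat_natAbs_of_nonpos hneg.le]
    simp
  · left
    refine ⟨hpos, ?_⟩
    rw [← h1, ← Int.cast_natCast, Int.natAbs_of_nonneg hpos.le]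

/-- Modulo `15` the right-hand side is `±64 ± 1`. With the signs `++`, `+-`, `-+` this is a
non-residue modulo `3` or modulo `5`, and with `--` the right-hand side is negative. -/
lemma sq_ne_of_forall_prime_dvd {A M N : ℤ} (hM : M ≠ 0) (hN : N ≠ 0)
    (h : ∀ ℓ : ℕ, ℓ.Prime → (ℓ : ℤ) ∣ M ∨ (ℓ : ℤ) ∣ N → (ℓ : ZMod 15) = 1) :
    A ^ 2 ≠ 64 * M + N := by
  intro heq
  have h15 := congrArg (Int.cast : ℤ → ZMod 15) heq
  push_cast at h15
  generalize (A : ZMod 15) = x at h15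
  rcases Int.pos_or_neg_cast_eq hM fun ℓ hℓ hd ↦ h ℓ hℓ (Or.inl hd) with ⟨hM0, hM1⟩ | ⟨hM0, hM1⟩ <;>
  rcases Int.pos_or_neg_cast_eq hN fun ℓ hℓ hd ↦ h ℓ hℓ (Or.inr hd) with ⟨hN0, hN1⟩ | ⟨hN0, hN1⟩
  · rw [hM1, hN1] at h15
    revert x
    decide
  · rw [hM1, hN1] at h15
    revert x
    decide
  · rw [hM1, hN1] at h15
    revert x
    decide
  · nlinarith [sq_nonneg A]

theorem proposition3p3 (p q : ℕ) (hp : p.Prime) (hq : q.Prime) (hpq : p ≠ q)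
    (hp60 : p ≡ 31 [MOD 60]) (hq60 : q ≡ 31 [MOD 60])
    (u v : (ZMod 16)ˣ) (hu : (u : ZMod 16) = (p : ZMod 16)) (hv : (v : ZMod 16) = (q : ZMod 16))
    (huv : u ∉ Subgroup.zpowers v) :
    ¬ ∃ W : WeierstrassCurve ℚ, W.IsElliptic ∧ W.HasConductor (p * q) ∧
      ∃ P : W.toAffine.Point, addOrderOf P = 2 := by
  rintro ⟨W, hW, hcond, P, hP⟩
  have cast_eq_one {r : ℕ} (hr : r ≡ 31 [MOD 60]) : (r : ZMod 15) = 1 :=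
    (ZMod.natCast_eq_natCast_iff r 31 15).2 (hr.of_mul_right 4)
  obtain ⟨x, hx⟩ := WeierstrassCurve.exists_root_of_addOrderOf_eq_two W hP
  have hΔ : (8 * W.b₄ + 8 * W.b₂ * x + 48 * x ^ 2) ^ 2 *
      ((W.b₂ + 12 * x) ^ 2 - 4 * (8 * W.b₄ + 8 * W.b₂ * x + 48 * x ^ 2)) ≠ 0 := by
    have hdisc := WeierstrassCurve.two_torsion_discr W (R := 4 * x) (by linear_combination 16 * hx)
    have h0 : (2 : ℚ) ^ 8 * W.Δ ≠ 0 := mul_ne_zero (by norm_num) hW.isUnit.ne_zero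
    rw [← hdisc] at h0
    convert h0 using 1
    ring
  have hS : (2 : ℕ) ∉ ({p, q} : Set ℕ) := by
    rintro (rfl | rfl)
    · exact absurd hp60 (by decide)
    · exact absurd hq60 (by decide)
  obtain ⟨A, M, N, heq, hM, hN, hprime⟩ := WeierstrassCurve.exists_sq_eq_of_isGoodModelAt hS
    (a₀ := W.b₂ + 12 * x) (b₀ := 8 * W.b₄ + 8 * W.b₂ * x + 48 * x ^ 2)
    (pow_ne_zero_iff two_ne_zero |>.1 (left_ne_zero_of_mul hΔ)) (right_ne_zero_of_mul hΔ)
    (fun ℓ hℓ hmem ↦ WeierstrassCurve.isGoodModelAt_of_hasGoodReduction W hx ℓ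
      (WeierstrassCurve.hasGoodReduction_of_hasConductor hcond ℓ fun hdvd ↦ hmem
        (((Nat.Prime.dvd_mul hℓ.out).1 hdvd).imp (Nat.prime_dvd_prime_iff_eq hℓ.out hp).1
          (Nat.prime_dvd_prime_iff_eq hℓ.out hq).1)))
  refine sq_ne_of_forall_prime_dvd hM hN (fun ℓ hℓ hdvd ↦ ?_) heq
  rcases hprime ℓ hℓ hdvd with rfl | rfl
  · exact cast_eq_one hp60
  · exact cast_eq_one hq60
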